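/- Let $L_+,L_0,L_-$ range over Conway (skein) triples of oriented links, i.e. links with diagrams that agree except at one crossing, which is positive in $L_+$, negative in $L_-$ and smoothed compatibly with the orientations in $L_0$. For $n\in\mathbb Z$ let $L_{n,2}$ be the closure of the braid $\sigma_1^n$ on two parallel strands; for odd $n$ it is the torus knot $T(n,2)$. Write $P_n=P_{L_{n,2}}$ for an isotopy invariant $P$ of oriented links. (1) For every $n\in\mathbb Z$, $(L_{n+1,2},L_{n,2},L_{n-1,2})$ is a Conway triple. Hence, if $P$ takes values in a commutative ring and satisfies $P_{L_+}=l_1P_{L_0}+l_2P_{L_-}$ for all Conway triples, then for all $n\in\mathbb Z$ $$P_{n+1}=l_1P_n+l_2P_{n-1},\qquad P_{n+2}=k_1P_n+k_2P_{n-2},\qquad k_1=l_1^2+2l_2,\quad k_2=-l_2^2 .$$ For odd $n$ the second recurrence involves only the torus knots $T(2m+1,2)$. If moreover $P_{\rm unknot}=1$, then $P_1=1$ and $P_3=k_1+k_2$. (2) Let $K$ be a field and $a,s\in K^\times$, and put $t=s^2$, so that $s=t^{1/2}$. For $K$-valued invariants, the skein relations $$\Delta_+-\Delta_-=(s-s^{-1})\Delta_0,\qquad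 t^{-1}V_+-tV_-=(s-s^{-1})V_0,\qquad a^{-1}H_+-aH_-=(s-s^{-1})H_0$$ (Alexander, Jones, HOMFLY) are equivalent to the general skein relation with coefficients $(l_1,l_2)$ equal to, respectively, $$(s-s^{-1},\,1),\qquad (s^3-s,\;t^2),\qquad (a(s-s^{-1}),\;a^2).$$ The invariants of $L_{n,2}$ therefore satisfy the recurrences in (1) with these $l_1,l_2$ and with $(k_1,k_2)$ equal to, respectively, $$(t+t^{-1},\,-1),\qquad (t^3+t,\;-t^4),\qquad (a^2(t+t^{-1}),\;-a^4).$$ (3) For $q,p\in K^\times$ with $q\ne p$ put $[n]_{q,p}=\frac{q^n-p^n}{q-p}$, $n\in\mathbb Z$. Then $[n+1]_{q,p}=(q+p)[n]_{q,p}-qp\,[n-1]_{q,p}$. For $a,t\in K^\times$ with $t^2\neq1$ define the bosonic numbers $$[n]^A=\frac{t^n-t^{-n}}{t-t^{-1}},\qquad [n]^V=\frac{t^{3n}-t^n}{t^3-t},\qquad [n]^H=a^{2(n-1)}\,\frac{t^n-t^{-n}}{t-t^{-1}} .$$ Each of these sequences takes the values $0,1$ at $n=0,1$. In each of the three cases,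 with $(k_1,k_2)$ as in (2), $[n]=[n]_{q,p}$ whenever $q+p=k_1$ and $qp=-k_2$. Moreover $(k_1,k_2)$ is the only pair of coefficients with $[n+1]=k_1[n]+k_2[n-1]$ for all $n\in\mathbb Z$. (4) Conversely, let $t=s^2$ with $t^2\ne 1$, and let $k_1,k_2$ be the coefficients of the recurrence of the respective bosonic numbers. The solutions in $K$ of $l_2^2=-k_2$, $l_1^2=k_1-2l_2$ are $l_2=1$, $l_1=\pm(s-s^{-1})$ and $l_2=-1$, $l_1=\pm(s+s^{-1})$ for Alexander; $l_2=t^2$, $l_1=\pm(s^3-s)$ and $l_2=-t^2$, $l_1=\pm(s^3+s)$ for Jones; $l_2=a^2$, $l_1=\pm a(s-s^{-1})$ and $l_2=-a^2$, $l_1=\pm a(s+s^{-1})$ for HOMFLY. In a linearly ordered field with $s>1$ and $a>0$, the nonnegative square roots $l_2=+(-k_2)^{1/2}$, $l_1=+(k_1-2l_2)^{1/2}$ exist and are exactly the skein coefficients listed in (2), and the general skein relation with these $l_1,l_2$ is equivalent to the Alexander, Jones or HOMFLY skein relation, respectively. -/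

import Mathlib

universe u v w

/-!
Oriented links are given by oriented link diagrams in the plane, cut into horizontal slices that
are read from bottom to top, up to planar isotopy and Reidemeister moves.
A point of a horizontal level line carries its direction: `true` is up, `false` is down.
-/

/-- Elementary pieces of an oriented diagram. `cup a` is a local minimum, with ends `a, !a` above
it; `cap a` is a local maximum, with ends `a, !a` below it; `crossing k a b` is a crossing with
ends `a, b` below and `b, a` above it. If `k = true`, the strand that runs between the lower left
and the upper right end is the overcrossing one; if `k = false`, it is the undercrossing one. -/
inductive Piece : Type
  | cup (a : Bool)
  | cap (a : Bool)
  | crossing (k a b : Bool)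

/-- The directions on the lower boundary of a piece. -/
def Piece.source : Piece → List Bool
  | .cup _ => []
  | .cap a => [a, !a]
  | .crossing _ a b => [a, b]

/-- The directions on the upper boundary of a piece. -/
def Piece.target : Piece → List Bool
  | .cup a => [a, !a]
  | .cap _ => []
  | .crossing _ a b => [b, a]

/-- A horizontal slice of a diagram: one piece, with vertical strands to its left and right. -/
structure Slice : Type where
  left : List Bool
  piece : Piece
  right : List Bool

def Slice.source (x : Slice) : List Bool := x.left ++ x.piece.source ++ x.right

def Slice.target (x : Slice) : List Bool := x.left ++ x.piece.target ++ x.right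

/-- Add vertical strands `l` to the left and `r` to the right of a slice. -/
def Slice.whisker (l r : List Bool) (x : Slice) : Slice := ⟨l ++ x.left, x.piece, x.right ++ r⟩

/-- `IsTangle σ w τ`: the slices in `w`, stacked from bottom to top, fit together to an oriented
tangle diagram with lower boundary `σ` and upper boundary `τ`. -/
def IsTangle : List Bool → List Slice → List Bool → Prop
  | σ, [], τ => σ = τ
  | σ, x :: w, τ => x.source = σ ∧ IsTangle x.target w τ

/-- An oriented link diagram: a tangle diagram without boundary. -/
structure LinkDiagram : Type where
  word : List Slice
  isTangle : IsTangle [] word []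

/-- The elementary moves: planar isotopy (`exchange`, `zigzag`, `slide`; the last one swings a
strand across a local extremum of another strand that crosses it) and the Reidemeister moves,
for all orientations of the strands. -/
inductive BasicMove : List Slice → List Slice → Prop
  | exchange (p q : Piece) (m : List Bool) :
      BasicMove [⟨[], p, m ++ q.source⟩, ⟨p.target ++ m, q, []⟩]
        [⟨p.source ++ m, q, []⟩, ⟨[], p, m ++ q.target⟩]
  | zigzag_left (a : Bool) :
      BasicMove [⟨[a], .cup (!a), []⟩, ⟨[], .cap a, [a]⟩] []
  | zigzag_right (a : Bool) :
      BasicMove [⟨[], .cup a, [a]⟩, ⟨[a], .cap (!a), []⟩] []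
  | slide_cap (k a c : Bool) :
      BasicMove [⟨[], .crossing k a c, [!a]⟩, ⟨[c], .cap a, []⟩]
        [⟨[a], .crossing (!k) c (!a), []⟩, ⟨[], .cap a, [c]⟩]
  | slide_cup (k a c : Bool) :
      BasicMove [⟨[c], .cup a, []⟩, ⟨[], .crossing k c a, [!a]⟩]
        [⟨[], .cup a, [c]⟩, ⟨[a], .crossing (!k) (!a) c, []⟩]
  | reidemeister1_right (k a : Bool) :
      BasicMove [⟨[a], .cup a, []⟩, ⟨[], .crossing k a a, [!a]⟩, ⟨[a], .cap a, []⟩] []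
  | reidemeister1_left (k a : Bool) :
      BasicMove [⟨[], .cup (!a), [a]⟩, ⟨[!a], .crossing k a a, []⟩, ⟨[], .cap (!a), [a]⟩] []
  | reidemeister2 (k a b : Bool) :
      BasicMove [⟨[], .crossing k a b, []⟩, ⟨[], .crossing (!k) b a, []⟩] []
  /-- The hypothesis says that the three strands lie at three different heights, that is, that
  "over" is not cyclic among them. -/
  | reidemeister3 (i j k a b c : Bool) (h : j = i ∨ j = k) :
      BasicMove
        [⟨[], .crossing i a b, [c]⟩, ⟨[b], .crossing j a c, []⟩, ⟨[], .crossing k b c, [a]⟩]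
        [⟨[a], .crossing k b c, []⟩, ⟨[], .crossing j a c, [b]⟩, ⟨[c], .crossing i a b, []⟩]

/-- Two link diagrams differ by one elementary move, applied somewhere in the diagram. -/
def LinkDiagram.Move (D D' : LinkDiagram) : Prop :=
  ∃ (x y u v : List Slice) (l r : List Bool), BasicMove x y ∧
    D.word = u ++ x.map (Slice.whisker l r) ++ v ∧
    D'.word = u ++ y.map (Slice.whisker l r) ++ v

/-- Oriented links up to isotopy: link diagrams modulo the equivalence relation generated by the
elementary moves. -/
def OrientedLink : Type := Quot LinkDiagram.Move

def LinkDiagram.toLink (D : LinkDiagram) : OrientedLink := Quot.mk _ D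

/-- The smoothing of a crossing with lower ends `a, b` that respects the orientations: two vertical
strands if both strands point in the same vertical direction, a maximum below a minimum
otherwise. -/
def smoothing (l r : List Bool) (a b : Bool) : List Slice :=
  if a = b then [] else [⟨l, .cap a, r⟩, ⟨l, .cup b, r⟩]

/-- Conway triple of diagrams: `D₊`, `D₀`, `D₋` agree except at one crossing, which is positive in
`D₊`, negative in `D₋` and smoothed in `D₀`. With lower ends `a, b`, the crossing `crossing k a b`
is positive (right-handed) if and only if `k = (a == b)`. -/
def DiagramTriple (Dp D0 Dm : LinkDiagram) : Prop :=
  ∃ (u v : List Slice) (l r : List Bool) (a b : Bool),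
    Dp.word = u ++ [⟨l, .crossing (a == b) a b, r⟩] ++ v ∧
    D0.word = u ++ smoothing l r a b ++ v ∧
    Dm.word = u ++ [⟨l, .crossing (!(a == b)) a b, r⟩] ++ v

/-- `L₊`, `L₀`, `L₋` is a Conway triple of oriented links: they have diagrams that differ only at
one crossing, as in `DiagramTriple`. -/
def SkeinTriple (Lp L0 Lm : OrientedLink) : Prop :=
  ∃ Dp D0 Dm : LinkDiagram, DiagramTriple Dp D0 Dm ∧
    Dp.toLink = Lp ∧ D0.toLink = L0 ∧ Dm.toLink = Lm

/-- The diagram of the unknot without crossings. -/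
def unknotDiagram : LinkDiagram where
  word := [⟨[], .cup true, []⟩, ⟨[], .cap true, []⟩]
  isTangle := by simp [IsTangle, Slice.source, Slice.target, Piece.source, Piece.target]

def unknot : OrientedLink := unknotDiagram.toLink

/-- `m` crossings, one above the other, between two upward strands; two downward strands on the
right, which close them up. The crossings are positive if `k = true`, negative if `k = false`. -/
def twistWord (k : Bool) (m : ℕ) : List Slice :=
  List.replicate m ⟨[], .crossing k true true, [false, false]⟩

theorem isTangle_twistWord (k : Bool) (m : ℕ) (w : List Slice)
    (h : IsTangle [true, true, false, false] w []) :
    IsTangle [true, true, false, false] (twistWord k m ++ w) [] := by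
  induction m with
  | zero => simpa [twistWord] using h
  | succ m ih => exact ⟨rfl, ih⟩

/-- The standard diagram of the torus link `L_{n,2}`: the closure of the braid `σ₁ⁿ` on two
parallel strands, with `|n|` crossings, positive for `n > 0` and negative for `n < 0`. -/
def torusDiagram (n : ℤ) : LinkDiagram where
  word := [⟨[], .cup true, []⟩, ⟨[true], .cup true, [false]⟩] ++
    (twistWord (decide (0 ≤ n)) n.natAbs ++
      [⟨[true], .cap true, [false]⟩, ⟨[], .cap true, []⟩])
  isTangle := by
    refine And.intro rfl (And.intro rfl (isTangle_twistWord _ _ _ ?_))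
    exact And.intro rfl (And.intro rfl rfl)

/-- The torus link `L_{n,2}`; it is the torus knot `T(n,2)` for odd `n`. -/
def torusLink (n : ℤ) : OrientedLink := (torusDiagram n).toLink

/-- The general skein relation `P(L₊) = l₁ P(L₀) + l₂ P(L₋)` for a link invariant `P`. -/
def Skein {R : Type u} [CommRing R] (l₁ l₂ : R) (P : OrientedLink → R) : Prop :=
  ∀ Lp L0 Lm : OrientedLink, SkeinTriple Lp L0 Lm → P Lp = l₁ * P L0 + l₂ * P Lm

section Field

variable {K : Type u} [Field K]

/-- The Alexander skein relation; `s` is `t^(1/2)`. -/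
def AlexanderSkein (s : K) (P : OrientedLink → K) : Prop :=
  ∀ Lp L0 Lm : OrientedLink, SkeinTriple Lp L0 Lm → P Lp - P Lm = (s - s⁻¹) * P L0

/-- The Jones skein relation; `s` is `t^(1/2)`. -/
def JonesSkein (s : K) (P : OrientedLink → K) : Prop :=
  ∀ Lp L0 Lm : OrientedLink, SkeinTriple Lp L0 Lm →
    (s ^ 2)⁻¹ * P Lp - s ^ 2 * P Lm = (s - s⁻¹) * P L0

/-- The HOMFLY skein relation in the variables `a` and `z = t^(1/2) - t^(-1/2)`;
`s` is `t^(1/2)`. -/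
def HomflySkein (a s : K) (P : OrientedLink → K) : Prop :=
  ∀ Lp L0 Lm : OrientedLink, SkeinTriple Lp L0 Lm →
    a⁻¹ * P Lp - a * P Lm = (s - s⁻¹) * P L0

/-- The bosonic `(q,p)`-numbers. -/
def qpNumber (q p : K) (n : ℤ) : K := (q ^ n - p ^ n) / (q - p)

/-- The Alexander bosonic numbers. -/
def alexanderNumber (t : K) (n : ℤ) : K := (t ^ n - t ^ (-n)) / (t - t⁻¹)

/-- The Jones bosonic numbers. -/
def jonesNumber (t : K) (n : ℤ) : K := (t ^ (3 * n) - t ^ n) / (t ^ 3 - t)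

/-- The HOMFLY bosonic numbers. -/
def homflyNumber (a t : K) (n : ℤ) : K :=
  a ^ (2 * (n - 1)) * ((t ^ n - t ^ (-n)) / (t - t⁻¹))

/-- The three-term recurrence `f (n + 1) = k₁ f n + k₂ f (n - 1)`. -/
def Recurrence (k₁ k₂ : K) (f : ℤ → K) : Prop :=
  ∀ n : ℤ, f (n + 1) = k₁ * f n + k₂ * f (n - 1)

/-- `l₂` is a square root of `-k₂`, and `l₁` is a square root of `k₁ - 2 l₂`. -/
def IsRootPair (k₁ k₂ l₁ l₂ : K) : Prop := l₂ ^ 2 = -k₂ ∧ l₁ ^ 2 = k₁ - 2 * l₂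

/-- `l₂` is the nonnegative square root of `-k₂`, and `l₁` is the nonnegative square root of
`k₁ - 2 l₂`. -/
def IsNonnegRootPair [LinearOrder K] (k₁ k₂ l₁ l₂ : K) : Prop :=
  IsRootPair k₁ k₂ l₁ l₂ ∧ 0 ≤ l₁ ∧ 0 ≤ l₂

end Field

/-!
The two strands of the braid `σ₁ⁿ` are parallel, so every crossing of `torusDiagram n` has the sign
of `n`, and smoothing one crossing removes it. For `n ≥ 0` switch one crossing of
`torusDiagram (n + 1)`: if `n ≥ 1`, the switched crossing cancels against its neighbour by a
Reidemeister II move, which leaves `torusDiagram (n - 1)`; for `n = 0` the result already is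
`torusDiagram (-1)`. For `n < 0` the same is done from the negative side. This is
`skeinTriple_torusLink`. The second recurrence comes from eliminating the terms
`P (torusLink (n ± 1))` from three consecutive instances of the first, and
`torusLink 1 = torusLink (-1) = unknot` by a Reidemeister I move.

The algebra is done once, for HOMFLY: the Alexander case is HOMFLY at `a = 1` and the Jones case is
HOMFLY at `a = t`, for the skein relations as well as for the bosonic numbers. The HOMFLY
numbers are the `(q,p)`-numbers with `{q, p} = {a² t, a² t⁻¹}`, the roots of
`X² - a² (t + t⁻¹) X + a⁴` (`homflyNumber_eq_qpNumber`). Finally `k₁ ∓ 2 a² = (a (s ∓ s⁻¹))²`, which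
gives the square roots.
-/

/-! ### Torus links and Conway triples -/

/-- The diagram `torusDiagram n`, with an arbitrary word `w` of crossings between the two upward
strands in place of the twists. -/
def twistClosure (w : List Slice)
    (h : IsTangle [true, true, false, false]
      (w ++ [⟨[true], .cap true, [false]⟩, ⟨[], .cap true, []⟩]) []) : LinkDiagram where
  word := [⟨[], .cup true, []⟩, ⟨[true], .cup true, [false]⟩] ++
    (w ++ [⟨[true], .cap true, [false]⟩, ⟨[], .cap true, []⟩])
  isTangle := by exact And.intro rfl (And.intro rfl h)

/-- A crossing between the two upward strands of `torusDiagram n`, positive if `k = true`. -/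
def twist (k : Bool) : Slice := ⟨[], .crossing k true true, [false, false]⟩

theorem isTangle_twist_twistWord (k k' : Bool) (m : ℕ) :
    IsTangle [true, true, false, false]
      ((twist k :: twistWord k' m) ++ [⟨[true], .cap true, [false]⟩, ⟨[], .cap true, []⟩]) [] :=
  And.intro rfl (isTangle_twistWord k' m _ (And.intro rfl (And.intro rfl rfl)))

theorem torusDiagram_word_natCast (m : ℕ) :
    (torusDiagram m).word = [⟨[], .cup true, []⟩, ⟨[true], .cup true, [false]⟩] ++
      (twistWord true m ++ [⟨[true], .cap true, [false]⟩, ⟨[], .cap true, []⟩]) := by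
  simp [torusDiagram]

theorem torusDiagram_word_neg_natCast (m : ℕ) :
    (torusDiagram (-m)).word = [⟨[], .cup true, []⟩, ⟨[true], .cup true, [false]⟩] ++
      (twistWord false m ++ [⟨[true], .cap true, [false]⟩, ⟨[], .cap true, []⟩]) := by
  cases m with
  | zero => simp [torusDiagram, twistWord]
  | succ m =>
    have h : decide (0 ≤ -((m + 1 : ℕ) : ℤ)) = false := by
      rw [decide_eq_false_iff_not]
      omega
    simp only [torusDiagram, h, Int.natAbs_neg, Int.natAbs_natCast]

/-- A crossing cancels, by a Reidemeister II move, against the first of the opposite crossings that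
follow it. -/
theorem toLink_twistClosure_eq {k : Bool} {m : ℕ} {D : LinkDiagram}
    (hD : D.word = [⟨[], .cup true, []⟩, ⟨[true], .cup true, [false]⟩] ++
      (twistWord k m ++ [⟨[true], .cap true, [false]⟩, ⟨[], .cap true, []⟩])) :
    (twistClosure (twist (!k) :: twistWord k (m + 1)) (isTangle_twist_twistWord _ _ _)).toLink =
      D.toLink := by
  refine Quot.sound ⟨_, _, [⟨[], .cup true, []⟩, ⟨[true], .cup true, [false]⟩],
    twistWord k m ++ [⟨[true], .cap true, [false]⟩, ⟨[], .cap true, []⟩], [], [false, false],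
    .reidemeister2 (!k) true true, ?_, ?_⟩
  · simp [twistClosure, twist, twistWord, Slice.whisker, List.replicate_succ]
  · simpa using hD

theorem skeinTriple_torusLink (n : ℤ) :
    SkeinTriple (torusLink (n + 1)) (torusLink n) (torusLink (n - 1)) := by
  -- switching and smoothing the lowest crossing, with `m` crossings of the type `k` above it
  have key : ∀ m : ℕ, ∀ Dp D0 Dm : LinkDiagram, ∀ k : Bool,
      Dp.word = (twistClosure (twist true :: twistWord k m) (isTangle_twist_twistWord _ _ _)).word →
      D0.word = [⟨[], .cup true, []⟩, ⟨[true], .cup true, [false]⟩] ++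
        (twistWord k m ++ [⟨[true], .cap true, [false]⟩, ⟨[], .cap true, []⟩]) →
      Dm.word = (twistClosure (twist false :: twistWord k m)
        (isTangle_twist_twistWord _ _ _)).word →
      DiagramTriple Dp D0 Dm := by
    intro m Dp D0 Dm k hp h0 hm
    refine ⟨[⟨[], .cup true, []⟩, ⟨[true], .cup true, [false]⟩],
      twistWord k m ++ [⟨[true], .cap true, [false]⟩, ⟨[], .cap true, []⟩],
      [], [false, false], true, true, ?_, ?_, ?_⟩
    · simp [hp, twistClosure, twist]
    · simp [h0, smoothing]
    · simp [hm, twistClosure, twist]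
  obtain ⟨m, rfl | rfl⟩ := n.eq_nat_or_neg
  · have hp : (torusDiagram ((m : ℤ) + 1)).word =
        (twistClosure (twist true :: twistWord true m) (isTangle_twist_twistWord _ _ _)).word :=
      torusDiagram_word_natCast (m + 1)
    cases m with
    | zero =>
      exact ⟨_, _, _, key 0 _ _ _ true hp (torusDiagram_word_natCast 0)
        (torusDiagram_word_neg_natCast 1), rfl, rfl, rfl⟩
    | succ m =>
      refine ⟨_, _, twistClosure (twist false :: twistWord true (m + 1))
        (isTangle_twist_twistWord _ _ _), key (m + 1) _ _ _ true hp
        (torusDiagram_word_natCast (m + 1)) rfl, rfl, rfl, ?_⟩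
      rw [show ((m + 1 : ℕ) : ℤ) - 1 = m by push_cast; ring]
      exact toLink_twistClosure_eq (torusDiagram_word_natCast m)
  · have hm : (torusDiagram (-(m : ℤ) - 1)).word =
        (twistClosure (twist false :: twistWord false m) (isTangle_twist_twistWord _ _ _)).word := by
      rw [show -(m : ℤ) - 1 = -((m + 1 : ℕ) : ℤ) by push_cast; ring]
      exact torusDiagram_word_neg_natCast (m + 1)
    cases m with
    | zero =>
      exact ⟨_, _, _, key 0 _ _ _ false (torusDiagram_word_natCast 1)
        (torusDiagram_word_neg_natCast 0) hm, rfl, rfl, rfl⟩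
    | succ m =>
      refine ⟨twistClosure (twist true :: twistWord false (m + 1))
        (isTangle_twist_twistWord _ _ _), _, _, key (m + 1) _ _ _ false rfl
        (torusDiagram_word_neg_natCast (m + 1)) hm, ?_, rfl, rfl⟩
      rw [show -((m + 1 : ℕ) : ℤ) + 1 = -m by push_cast; ring]
      exact toLink_twistClosure_eq (torusDiagram_word_neg_natCast m)

/-- The closure of a single crossing is unknotted by a Reidemeister I move. -/
theorem toLink_eq_unknot {k : Bool} {D : LinkDiagram}
    (hD : D.word = [⟨[], .cup true, []⟩, ⟨[true], .cup true, [false]⟩] ++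
      (twistWord k 1 ++ [⟨[true], .cap true, [false]⟩, ⟨[], .cap true, []⟩])) :
    D.toLink = unknot := by
  refine Quot.sound ⟨_, _, [⟨[], .cup true, []⟩], [⟨[], .cap true, []⟩], [], [false],
    .reidemeister1_right k true, ?_, ?_⟩
  · simp [hD, twistWord, Slice.whisker]
  · simp [unknotDiagram]

theorem torusLink_one : torusLink 1 = unknot := toLink_eq_unknot (torusDiagram_word_natCast 1)

theorem torusLink_neg_one : torusLink (-1) = unknot :=
  toLink_eq_unknot (torusDiagram_word_neg_natCast 1)

/-! ### Recurrences from a skein relation -/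

section Skein

variable {R : Type u} [CommRing R] {l₁ l₂ : R} {P : OrientedLink → R}

theorem Skein.torusLink_add_one (h : Skein l₁ l₂ P) (n : ℤ) :
    P (torusLink (n + 1)) = l₁ * P (torusLink n) + l₂ * P (torusLink (n - 1)) :=
  h _ _ _ (skeinTriple_torusLink n)

theorem Skein.torusLink_add_two (h : Skein l₁ l₂ P) (n : ℤ) :
    P (torusLink (n + 2)) =
      (l₁ ^ 2 + 2 * l₂) * P (torusLink n) - l₂ ^ 2 * P (torusLink (n - 2)) := by
  have h₁ := h.torusLink_add_one (n + 1)
  have h₂ := h.torusLink_add_one n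
  have h₃ := h.torusLink_add_one (n - 1)
  rw [show n + 1 + 1 = n + 2 by ring, show n + 1 - 1 = n by ring] at h₁
  rw [show n - 1 + 1 = n by ring, show n - 1 - 1 = n - 2 by ring] at h₃
  linear_combination h₁ + l₁ * h₂ - l₂ * h₃

theorem Skein.torusLink_three (h : Skein l₁ l₂ P) (hP : P unknot = 1) :
    P (torusLink 3) = (l₁ ^ 2 + 2 * l₂) + -l₂ ^ 2 := by
  have := h.torusLink_add_two 1
  norm_num [torusLink_one, torusLink_neg_one, hP] at this
  rw [this]
  ring

end Skein

/-! ### The HOMFLY skein relation and its specializations -/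

section Field

variable {K : Type u} [Field K]

theorem homflySkein_iff_skein {a : K} (ha : a ≠ 0) (s : K) (P : OrientedLink → K) :
    HomflySkein a s P ↔ Skein (a * (s - s⁻¹)) (a ^ 2) P := by
  refine forall₄_congr fun Lp L0 Lm _ => ⟨fun h => ?_, fun h => ?_⟩
  · field_simp at h ⊢
    linear_combination h
  · rw [h]
    field_simp
    ring

theorem alexanderSkein_iff_homflySkein (s : K) (P : OrientedLink → K) :
    AlexanderSkein s P ↔ HomflySkein 1 s P := by
  simp [AlexanderSkein, HomflySkein]

theorem alexanderSkein_iff_skein (s : K) (P : OrientedLink → K) :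
    AlexanderSkein s P ↔ Skein (s - s⁻¹) 1 P := by
  rw [alexanderSkein_iff_homflySkein, homflySkein_iff_skein one_ne_zero, one_mul, one_pow]

theorem sq_mul_sub_inv {s : K} (hs : s ≠ 0) : s ^ 2 * (s - s⁻¹) = s ^ 3 - s := by
  field_simp

theorem sq_mul_add_inv {s : K} (hs : s ≠ 0) : s ^ 2 * (s + s⁻¹) = s ^ 3 + s := by
  field_simp

theorem jonesSkein_iff_skein {s : K} (hs : s ≠ 0) (P : OrientedLink → K) :
    JonesSkein s P ↔ Skein (s ^ 3 - s) ((s ^ 2) ^ 2) P := by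
  rw [← sq_mul_sub_inv hs]
  exact homflySkein_iff_skein (pow_ne_zero 2 hs) s P

/-! ### Bosonic numbers -/

theorem recurrence_qpNumber {q p : K} (hq : q ≠ 0) (hp : p ≠ 0) :
    Recurrence (q + p) (-(q * p)) (qpNumber q p) := by
  intro n
  simp only [qpNumber, zpow_add₀ hq, zpow_add₀ hp, zpow_sub₀ hq, zpow_sub₀ hp, zpow_one]
  field_simp
  ring

theorem qpNumber_comm (q p : K) : qpNumber q p = qpNumber p q := by
  funext n
  rw [qpNumber, qpNumber, ← neg_sub (p ^ n), ← neg_sub p q, neg_div_neg_eq]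

/-- The sum and the product determine `{q, p}` as the roots of a monic quadratic polynomial, and
the `(q,p)`-numbers are symmetric in `q` and `p`. -/
theorem qpNumber_eq_of_add_eq_of_mul_eq {q p x y : K} (hadd : q + p = x + y)
    (hmul : q * p = x * y) : qpNumber q p = qpNumber x y := by
  have h : (q - x) * (q - y) = 0 := by linear_combination q * hadd - hmul
  rcases mul_eq_zero.mp h with h | h
  · have hq : q = x := sub_eq_zero.mp h
    have hp : p = y := by linear_combination hadd - hq
    rw [hq, hp]
  · have hq : q = y := sub_eq_zero.mp h
    have hp : p = x := by linear_combination hadd - hq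
    rw [hq, hp, qpNumber_comm]

/-- A sequence with initial values `0, 1` satisfies at most one three-term recurrence, since its
values at `2` and `3` determine the coefficients. -/
theorem Recurrence.iff_of_zero_one {f : ℤ → K} (h₀ : f 0 = 0) (h₁ : f 1 = 1) {c₁ c₂ : K}
    (hf : Recurrence c₁ c₂ f) (k₁ k₂ : K) : Recurrence k₁ k₂ f ↔ k₁ = c₁ ∧ k₂ = c₂ := by
  refine ⟨fun h => ?_, fun ⟨e₁, e₂⟩ => e₁ ▸ e₂ ▸ hf⟩
  have a₁ := hf 1
  have b₁ := h 1
  have a₂ := hf 2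
  have b₂ := h 2
  norm_num [h₀, h₁] at a₁ b₁ a₂ b₂
  have e : k₁ = c₁ := b₁.symm.trans a₁
  refine ⟨e, ?_⟩
  rw [e] at b₂
  linear_combination a₂ - b₂

theorem sub_inv_ne_zero_of_sq_ne_one {t : K} (ht : t ≠ 0) (ht2 : t ^ 2 ≠ 1) : t - t⁻¹ ≠ 0 := by
  intro h
  apply ht2
  field_simp at h
  linear_combination h

theorem homflyNumber_zero (a t : K) : homflyNumber a t 0 = 0 := by
  simp [homflyNumber]

theorem homflyNumber_one (a : K) {t : K} (ht : t ≠ 0) (ht2 : t ^ 2 ≠ 1) :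
    homflyNumber a t 1 = 1 := by
  simp [homflyNumber, div_self (sub_inv_ne_zero_of_sq_ne_one ht ht2)]

theorem homflyNumber_eq_qpNumber {a : K} (ha : a ≠ 0) (t : K) :
    homflyNumber a t = qpNumber (a ^ 2 * t) (a ^ 2 * t⁻¹) := by
  funext n
  have h : a ^ (2 * (n - 1)) = (a ^ 2) ^ n / a ^ 2 := by
    rw [zpow_mul, zpow_sub_one₀ (zpow_ne_zero 2 ha), div_eq_mul_inv]
    norm_cast
  rw [homflyNumber, qpNumber, h, mul_zpow, mul_zpow, inv_zpow', ← mul_sub, ← mul_sub,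
    div_mul_div_comm]

theorem homflyNumber_eq_qpNumber_of_add_of_mul {a t : K} (ha : a ≠ 0) (ht : t ≠ 0) {q p : K}
    (hadd : q + p = a ^ 2 * (t + t⁻¹)) (hmul : q * p = a ^ 4) :
    homflyNumber a t = qpNumber q p := by
  rw [homflyNumber_eq_qpNumber ha]
  refine (qpNumber_eq_of_add_eq_of_mul_eq (by rw [hadd, mul_add]) ?_).symm
  rw [hmul]
  field_simp

theorem recurrence_homflyNumber_iff {a t : K} (ha : a ≠ 0) (ht : t ≠ 0) (ht2 : t ^ 2 ≠ 1)
    (k₁ k₂ : K) :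
    Recurrence k₁ k₂ (homflyNumber a t) ↔ k₁ = a ^ 2 * (t + t⁻¹) ∧ k₂ = -a ^ 4 := by
  refine Recurrence.iff_of_zero_one (homflyNumber_zero a t) (homflyNumber_one a ht ht2) ?_ k₁ k₂
  have h := recurrence_qpNumber (mul_ne_zero (pow_ne_zero 2 ha) ht)
    (mul_ne_zero (pow_ne_zero 2 ha) (inv_ne_zero ht))
  rw [← homflyNumber_eq_qpNumber ha, ← mul_add,
    show a ^ 2 * t * (a ^ 2 * t⁻¹) = a ^ 4 by field_simp] at h
  exact h

theorem alexanderNumber_eq_homflyNumber (t : K) : alexanderNumber t = homflyNumber 1 t := by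
  funext n
  simp [alexanderNumber, homflyNumber]

theorem jonesNumber_eq_homflyNumber {t : K} (ht : t ≠ 0) : jonesNumber t = homflyNumber t t := by
  rw [homflyNumber_eq_qpNumber ht]
  funext n
  rw [jonesNumber, qpNumber, show t ^ 2 * t = t ^ 3 by ring,
    show t ^ 2 * t⁻¹ = t by field_simp, zpow_mul]
  norm_cast

theorem recurrence_alexanderNumber_iff {t : K} (ht : t ≠ 0) (ht2 : t ^ 2 ≠ 1) (k₁ k₂ : K) :
    Recurrence k₁ k₂ (alexanderNumber t) ↔ k₁ = t + t⁻¹ ∧ k₂ = -1 := by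
  rw [alexanderNumber_eq_homflyNumber, recurrence_homflyNumber_iff one_ne_zero ht ht2]
  simp

theorem recurrence_jonesNumber_iff {t : K} (ht : t ≠ 0) (ht2 : t ^ 2 ≠ 1) (k₁ k₂ : K) :
    Recurrence k₁ k₂ (jonesNumber t) ↔ k₁ = t ^ 3 + t ∧ k₂ = -t ^ 4 := by
  rw [jonesNumber_eq_homflyNumber ht, recurrence_homflyNumber_iff ht ht ht2,
    sq_mul_add_inv ht]

/-! ### Skein coefficients as square roots -/

/-- If `k₁ - 2 m = x²` and `k₁ + 2 m = y²`, the pairs of square roots are `m, ±x` and `-m, ±y`. -/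
theorem isRootPair_iff {k₁ k₂ m x y : K} (h₂ : k₂ = -m ^ 2) (hx : k₁ - 2 * m = x ^ 2)
    (hy : k₁ + 2 * m = y ^ 2) (l₁ l₂ : K) :
    IsRootPair k₁ k₂ l₁ l₂ ↔ l₂ = m ∧ (l₁ = x ∨ l₁ = -x) ∨ l₂ = -m ∧ (l₁ = y ∨ l₁ = -y) := by
  rw [IsRootPair, h₂, neg_neg, sq_eq_sq_iff_eq_or_eq_neg, or_and_right, ← sq_eq_sq_iff_eq_or_eq_neg,
    ← sq_eq_sq_iff_eq_or_eq_neg]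
  refine or_congr (and_congr_right fun h => ?_) (and_congr_right fun h => ?_)
  · rw [h, hx]
  · rw [h, mul_neg, sub_neg_eq_add, hy]

theorem isNonnegRootPair_iff [LinearOrder K] [IsStrictOrderedRing K] {k₁ k₂ m x : K}
    (h₂ : k₂ = -m ^ 2) (hx : k₁ - 2 * m = x ^ 2) (hm : 0 ≤ m) (hx0 : 0 ≤ x) (l₁ l₂ : K) :
    IsNonnegRootPair k₁ k₂ l₁ l₂ ↔ l₁ = x ∧ l₂ = m := by
  constructor
  · rintro ⟨⟨e₂, e₁⟩, n₁, n₂⟩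
    have h : l₂ = m := (sq_eq_sq₀ n₂ hm).mp (by rw [e₂, h₂, neg_neg])
    exact ⟨(sq_eq_sq₀ n₁ hx0).mp (by rw [e₁, h, hx]), h⟩
  · rintro ⟨rfl, rfl⟩
    exact ⟨⟨by rw [h₂, neg_neg], hx.symm⟩, hx0, hm⟩

theorem homfly_sub_two_mul (a : K) {s : K} (hs : s ≠ 0) :
    a ^ 2 * (s ^ 2 + (s ^ 2)⁻¹) - 2 * a ^ 2 = (a * (s - s⁻¹)) ^ 2 := by
  field_simp
  ring

theorem homfly_add_two_mul (a : K) {s : K} (hs : s ≠ 0) :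
    a ^ 2 * (s ^ 2 + (s ^ 2)⁻¹) + 2 * a ^ 2 = (a * (s + s⁻¹)) ^ 2 := by
  field_simp
  ring

theorem isRootPair_iff_of_recurrence_homflyNumber {a s : K} (ha : a ≠ 0) (hs : s ≠ 0)
    (hs2 : (s ^ 2) ^ 2 ≠ 1) {k₁ k₂ : K} (h : Recurrence k₁ k₂ (homflyNumber a (s ^ 2)))
    (l₁ l₂ : K) :
    IsRootPair k₁ k₂ l₁ l₂ ↔
      l₂ = a ^ 2 ∧ (l₁ = a * (s - s⁻¹) ∨ l₁ = -(a * (s - s⁻¹))) ∨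
      l₂ = -a ^ 2 ∧ (l₁ = a * (s + s⁻¹) ∨ l₁ = -(a * (s + s⁻¹))) := by
  obtain ⟨rfl, rfl⟩ := (recurrence_homflyNumber_iff ha (pow_ne_zero 2 hs) hs2 k₁ k₂).mp h
  exact isRootPair_iff (by ring) (homfly_sub_two_mul a hs) (homfly_add_two_mul a hs) l₁ l₂

theorem isNonnegRootPair_iff_of_recurrence_homflyNumber [LinearOrder K] [IsStrictOrderedRing K]
    {a s : K} (ha : 0 < a) (hs : 1 < s) {k₁ k₂ : K}
    (h : Recurrence k₁ k₂ (homflyNumber a (s ^ 2))) (l₁ l₂ : K) :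
    IsNonnegRootPair k₁ k₂ l₁ l₂ ↔ l₁ = a * (s - s⁻¹) ∧ l₂ = a ^ 2 := by
  have hs0 : s ≠ 0 := (zero_lt_one.trans hs).ne'
  have hs2 : (s ^ 2) ^ 2 ≠ 1 := by
    rw [← pow_mul]
    exact (one_lt_pow₀ hs (by norm_num)).ne'
  obtain ⟨rfl, rfl⟩ := (recurrence_homflyNumber_iff ha.ne' (pow_ne_zero 2 hs0) hs2 k₁ k₂).mp h
  have hinv : s⁻¹ ≤ s := (inv_le_one_of_one_le₀ hs.le).trans hs.le
  exact isNonnegRootPair_iff (by ring) (homfly_sub_two_mul a hs0) (sq_nonneg a)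
    (mul_nonneg ha.le (sub_nonneg.mpr hinv)) l₁ l₂

end Field

theorem mainTheorem3 {R : Type u} [CommRing R] {K : Type v} [Field K]
    {F : Type w} [Field F] [LinearOrder F] [IsStrictOrderedRing F] :
    -- the torus links form Conway triples
    (∀ n : ℤ, SkeinTriple (torusLink (n + 1)) (torusLink n) (torusLink (n - 1))) ∧
    -- the recurrences for an arbitrary skein relation
    (∀ (l₁ l₂ : R) (P : OrientedLink → R), Skein l₁ l₂ P →
      (∀ n : ℤ, P (torusLink (n + 1)) = l₁ * P (torusLink n) + l₂ * P (torusLink (n - 1))) ∧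
      (∀ n : ℤ, P (torusLink (n + 2)) =
        (l₁ ^ 2 + 2 * l₂) * P (torusLink n) - l₂ ^ 2 * P (torusLink (n - 2))) ∧
      (P unknot = 1 → P (torusLink 1) = 1 ∧
        P (torusLink 3) = (l₁ ^ 2 + 2 * l₂) + -l₂ ^ 2)) ∧
    -- the recurrence of the (q,p)-numbers
    (∀ q p : K, q ≠ 0 → p ≠ 0 → q ≠ p → Recurrence (q + p) (-(q * p)) (qpNumber q p)) ∧
    -- the Alexander, Jones and HOMFLY cases
    (∀ s : K, s ≠ 0 → ∀ P : OrientedLink → K,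
      (AlexanderSkein s P ↔ Skein (s - s⁻¹) 1 P) ∧
      (AlexanderSkein s P →
        (∀ n : ℤ, P (torusLink (n + 1)) =
          (s - s⁻¹) * P (torusLink n) + P (torusLink (n - 1))) ∧
        (∀ n : ℤ, P (torusLink (n + 2)) =
          (s ^ 2 + (s ^ 2)⁻¹) * P (torusLink n) - P (torusLink (n - 2))))) ∧
    (∀ s : K, s ≠ 0 → ∀ P : OrientedLink → K,
      (JonesSkein s P ↔ Skein (s ^ 3 - s) ((s ^ 2) ^ 2) P) ∧
      (JonesSkein s P →
        (∀ n : ℤ, P (torusLink (n + 1)) =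
          (s ^ 3 - s) * P (torusLink n) + (s ^ 2) ^ 2 * P (torusLink (n - 1))) ∧
        (∀ n : ℤ, P (torusLink (n + 2)) =
          ((s ^ 2) ^ 3 + s ^ 2) * P (torusLink n) - (s ^ 2) ^ 4 * P (torusLink (n - 2))))) ∧
    (∀ a s : K, a ≠ 0 → s ≠ 0 → ∀ P : OrientedLink → K,
      (HomflySkein a s P ↔ Skein (a * (s - s⁻¹)) (a ^ 2) P) ∧
      (HomflySkein a s P →
        (∀ n : ℤ, P (torusLink (n + 1)) =
          a * (s - s⁻¹) * P (torusLink n) + a ^ 2 * P (torusLink (n - 1))) ∧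
        (∀ n : ℤ, P (torusLink (n + 2)) =
          a ^ 2 * (s ^ 2 + (s ^ 2)⁻¹) * P (torusLink n) - a ^ 4 * P (torusLink (n - 2))))) ∧
    -- the bosonic numbers with the same recurrences, which determine the coefficients k₁, k₂
    (∀ t : K, t ≠ 0 → t ^ 2 ≠ 1 →
      alexanderNumber t 0 = 0 ∧ alexanderNumber t 1 = 1 ∧
      (∀ q p : K, q + p = t + t⁻¹ → q * p = 1 → alexanderNumber t = qpNumber q p) ∧
      (∀ k₁ k₂ : K, Recurrence k₁ k₂ (alexanderNumber t) ↔ k₁ = t + t⁻¹ ∧ k₂ = -1)) ∧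
    (∀ t : K, t ≠ 0 → t ^ 2 ≠ 1 →
      jonesNumber t 0 = 0 ∧ jonesNumber t 1 = 1 ∧
      (∀ q p : K, q + p = t ^ 3 + t → q * p = t ^ 4 → jonesNumber t = qpNumber q p) ∧
      (∀ k₁ k₂ : K, Recurrence k₁ k₂ (jonesNumber t) ↔ k₁ = t ^ 3 + t ∧ k₂ = -t ^ 4)) ∧
    (∀ a t : K, a ≠ 0 → t ≠ 0 → t ^ 2 ≠ 1 →
      homflyNumber a t 0 = 0 ∧ homflyNumber a t 1 = 1 ∧
      (∀ q p : K, q + p = a ^ 2 * (t + t⁻¹) → q * p = a ^ 4 →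
        homflyNumber a t = qpNumber q p) ∧
      (∀ k₁ k₂ : K, Recurrence k₁ k₂ (homflyNumber a t) ↔
        k₁ = a ^ 2 * (t + t⁻¹) ∧ k₂ = -a ^ 4)) ∧
    -- the skein coefficients from the numbers, in any field, up to the signs of the square roots
    (∀ s : K, s ≠ 0 → (s ^ 2) ^ 2 ≠ 1 → ∀ k₁ k₂ : K,
      Recurrence k₁ k₂ (alexanderNumber (s ^ 2)) → ∀ l₁ l₂ : K, IsRootPair k₁ k₂ l₁ l₂ ↔
        l₂ = 1 ∧ (l₁ = s - s⁻¹ ∨ l₁ = -(s - s⁻¹)) ∨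
        l₂ = -1 ∧ (l₁ = s + s⁻¹ ∨ l₁ = -(s + s⁻¹))) ∧
    (∀ s : K, s ≠ 0 → (s ^ 2) ^ 2 ≠ 1 → ∀ k₁ k₂ : K,
      Recurrence k₁ k₂ (jonesNumber (s ^ 2)) → ∀ l₁ l₂ : K, IsRootPair k₁ k₂ l₁ l₂ ↔
        l₂ = (s ^ 2) ^ 2 ∧ (l₁ = s ^ 3 - s ∨ l₁ = -(s ^ 3 - s)) ∨
        l₂ = -(s ^ 2) ^ 2 ∧ (l₁ = s ^ 3 + s ∨ l₁ = -(s ^ 3 + s))) ∧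
    (∀ a s : K, a ≠ 0 → s ≠ 0 → (s ^ 2) ^ 2 ≠ 1 → ∀ k₁ k₂ : K,
      Recurrence k₁ k₂ (homflyNumber a (s ^ 2)) → ∀ l₁ l₂ : K, IsRootPair k₁ k₂ l₁ l₂ ↔
        l₂ = a ^ 2 ∧ (l₁ = a * (s - s⁻¹) ∨ l₁ = -(a * (s - s⁻¹))) ∨
        l₂ = -a ^ 2 ∧ (l₁ = a * (s + s⁻¹) ∨ l₁ = -(a * (s + s⁻¹)))) ∧
    -- the skein coefficients and skein relations from the numbers, with nonnegative square roots
    (∀ s : F, 1 < s → ∀ k₁ k₂ : F, Recurrence k₁ k₂ (alexanderNumber (s ^ 2)) →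
      ∀ l₁ l₂ : F, (IsNonnegRootPair k₁ k₂ l₁ l₂ ↔ l₁ = s - s⁻¹ ∧ l₂ = 1) ∧
        (IsNonnegRootPair k₁ k₂ l₁ l₂ →
          ∀ P : OrientedLink → F, Skein l₁ l₂ P ↔ AlexanderSkein s P)) ∧
    (∀ s : F, 1 < s → ∀ k₁ k₂ : F, Recurrence k₁ k₂ (jonesNumber (s ^ 2)) →
      ∀ l₁ l₂ : F, (IsNonnegRootPair k₁ k₂ l₁ l₂ ↔ l₁ = s ^ 3 - s ∧ l₂ = (s ^ 2) ^ 2) ∧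
        (IsNonnegRootPair k₁ k₂ l₁ l₂ →
          ∀ P : OrientedLink → F, Skein l₁ l₂ P ↔ JonesSkein s P)) ∧
    (∀ a s : F, 0 < a → 1 < s → ∀ k₁ k₂ : F, Recurrence k₁ k₂ (homflyNumber a (s ^ 2)) →
      ∀ l₁ l₂ : F, (IsNonnegRootPair k₁ k₂ l₁ l₂ ↔ l₁ = a * (s - s⁻¹) ∧ l₂ = a ^ 2) ∧
        (IsNonnegRootPair k₁ k₂ l₁ l₂ →
          ∀ P : OrientedLink → F, Skein l₁ l₂ P ↔ HomflySkein a s P)) := by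
  refine ⟨skeinTriple_torusLink, fun l₁ l₂ P h => ⟨h.torusLink_add_one, h.torusLink_add_two,
      fun hP => ⟨by rw [torusLink_one, hP], h.torusLink_three hP⟩⟩,
    fun q p hq hp _ => recurrence_qpNumber hq hp, ?_, ?_, ?_, ?_, ?_, ?_, ?_, ?_, ?_, ?_, ?_, ?_⟩
  · refine fun s hs P => ⟨alexanderSkein_iff_skein s P, fun h => ?_⟩
    rw [alexanderSkein_iff_skein] at h
    refine ⟨fun n => by rw [h.torusLink_add_one, one_mul], fun n => ?_⟩
    rw [h.torusLink_add_two]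
    field_simp
    ring
  · refine fun s hs P => ⟨jonesSkein_iff_skein hs P, fun h => ?_⟩
    rw [jonesSkein_iff_skein hs] at h
    refine ⟨h.torusLink_add_one, fun n => ?_⟩
    rw [h.torusLink_add_two]
    ring
  · refine fun a s ha hs P => ⟨homflySkein_iff_skein ha s P, fun h => ?_⟩
    rw [homflySkein_iff_skein ha] at h
    refine ⟨h.torusLink_add_one, fun n => ?_⟩
    rw [h.torusLink_add_two, ← homfly_sub_two_mul a hs]
    ring
  · refine fun t ht ht2 => ⟨?_, ?_, fun q p hadd hmul => ?_, recurrence_alexanderNumber_iff ht ht2⟩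
    · rw [alexanderNumber_eq_homflyNumber, homflyNumber_zero]
    · rw [alexanderNumber_eq_homflyNumber, homflyNumber_one 1 ht ht2]
    · rw [alexanderNumber_eq_homflyNumber]
      exact homflyNumber_eq_qpNumber_of_add_of_mul one_ne_zero ht (by simpa using hadd)
        (by simpa using hmul)
  · refine fun t ht ht2 => ⟨?_, ?_, fun q p hadd hmul => ?_, recurrence_jonesNumber_iff ht ht2⟩
    · rw [jonesNumber_eq_homflyNumber ht, homflyNumber_zero]
    · rw [jonesNumber_eq_homflyNumber ht, homflyNumber_one t ht ht2]
    · rw [jonesNumber_eq_homflyNumber ht]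
      refine homflyNumber_eq_qpNumber_of_add_of_mul ht ht ?_ hmul
      rw [hadd, sq_mul_add_inv ht]
  · exact fun a t ha ht ht2 => ⟨homflyNumber_zero a t, homflyNumber_one a ht ht2,
      fun q p => homflyNumber_eq_qpNumber_of_add_of_mul ha ht,
      recurrence_homflyNumber_iff ha ht ht2⟩
  · intro s hs hs2 k₁ k₂ h l₁ l₂
    rw [alexanderNumber_eq_homflyNumber] at h
    simpa using isRootPair_iff_of_recurrence_homflyNumber one_ne_zero hs hs2 h l₁ l₂
  · intro s hs hs2 k₁ k₂ h l₁ l₂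
    rw [jonesNumber_eq_homflyNumber (pow_ne_zero 2 hs)] at h
    rw [isRootPair_iff_of_recurrence_homflyNumber (pow_ne_zero 2 hs) hs hs2 h, sq_mul_sub_inv hs,
      sq_mul_add_inv hs]
  · exact fun a s ha hs hs2 k₁ k₂ => isRootPair_iff_of_recurrence_homflyNumber ha hs hs2
  · intro s hs k₁ k₂ h l₁ l₂
    rw [alexanderNumber_eq_homflyNumber] at h
    have key : IsNonnegRootPair k₁ k₂ l₁ l₂ ↔ l₁ = s - s⁻¹ ∧ l₂ = 1 := by
      simpa using isNonnegRootPair_iff_of_recurrence_homflyNumber one_pos hs h l₁ l₂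
    refine ⟨key, fun hl P => ?_⟩
    obtain ⟨rfl, rfl⟩ := key.mp hl
    exact (alexanderSkein_iff_skein s P).symm
  · intro s hs k₁ k₂ h l₁ l₂
    have hs0 : 0 < s := zero_lt_one.trans hs
    rw [jonesNumber_eq_homflyNumber (pow_ne_zero 2 hs0.ne')] at h
    have key : IsNonnegRootPair k₁ k₂ l₁ l₂ ↔ l₁ = s ^ 3 - s ∧ l₂ = (s ^ 2) ^ 2 := by
      rw [isNonnegRootPair_iff_of_recurrence_homflyNumber (pow_pos hs0 2) hs h,
        sq_mul_sub_inv hs0.ne']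
    refine ⟨key, fun hl P => ?_⟩
    obtain ⟨rfl, rfl⟩ := key.mp hl
    exact (jonesSkein_iff_skein hs0.ne' P).symm
  · intro a s ha hs k₁ k₂ h l₁ l₂
    have key := isNonnegRootPair_iff_of_recurrence_homflyNumber ha hs h l₁ l₂
    refine ⟨key, fun hl P => ?_⟩
    obtain ⟨rfl, rfl⟩ := key.mp hl
    exact (homflySkein_iff_skein ha.ne' s P).symm
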